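/- **Setting.** Let $M$ be a smooth, second countable Hausdorff manifold of dimension $n\ge 2$ with a (not necessarily smooth or continuous) Riemannian metric $g$ whose coefficients in charts are measurable, locally bounded and locally uniformly elliptic. ($M$ need not be complete; in particular a manifold with conical singularities is covered by removing the singular points, which have zero capacity.) Let $m$ be the Riemannian volume, $\mathcal E(u)=\int_M|\nabla u|^2\,dm$ the Dirichlet form with domain $\mathcal D(\mathcal E)=W^{1,2}(M)$, defined through weak gradients, $\mathcal D_{\rm loc}(\mathcal E)=W^{1,2}_{\rm loc}(M)$, and $\Delta$ the generator: $u\in\mathcal D(\Delta)$ with $\Delta u=f$ iff $u\in \mathcal D(\mathcal E)$, $f\in L^2(M,m)$ and $\int\nabla u\cdot\nabla w\,dm=-\int f w\,dm$ for all $w\in\mathcal D(\mathcal E)$. Let $N\in[1,\infty]$ and let $k:M\to\mathbb R$ be measurable, $k^\pm=\max(\pm k,0)$. The *mild Bakry–Émery inequality* ${\sf BE}_1'(k,N)$ means: for every $u\in\mathcal D(\Delta)$ the function $v:=|\nabla u|$ belongs to $\mathcal D(\mathcal E)$, and for every $\varphi\in\mathcal D_{\rm loc}(\mathcal E)\cap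 L^\infty$ with $\varphi\ge0$ and $|\nabla\varphi|\in L^\infty$, $$\int\nabla\varphi\cdot\Big[-\tfrac12\nabla(v^2)+\nabla u\,\Delta u\Big]dm+\int\varphi(\Delta u)^2dm+\int k^-\varphi v^2dm\ \ge\ \int k^+\varphi v^2dm+\int\varphi|\nabla v|^2dm+\frac1{N-1}\int\varphi\,\big||\nabla v|-|\Delta u|\big|^2dm$$ (with $\frac1{N-1}=0$ for $N=\infty$, $\frac1{N-1}=\infty$ for $N=1$, and $\infty\cdot0=0$; integrals involving $k^{\pm}$ may be $+\infty$). Let $\lambda_1^{(p)}:=\inf\big({\rm spec}_p(-\Delta)\setminus\{0\}\big)\in[0,\infty]$, where ${\rm spec}_p$ is the set of eigenvalues in $L^2(M,m)$ and $\inf\emptyset=+\infty$. For $c\ge0$ let $-c\Delta+k$ be the self-adjoint operator in $L^2(M,m)$ associated with (the closure of) the quadratic form $v\mapsto c\int|\nabla v|^2dm+\int kv^2dm$ on $\{v\in\mathcal D(\mathcal E):\int|k|v^2dm<\infty\}$, if $\int k^-v^2\,dm<\infty$ for all $v\in\mathcal D(\mathcal E)$ and this form is bounded from below by a multiple of $\|v\|_{L^2}^2$;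 otherwise put $\inf{\rm spec}(-c\Delta+k):=-\infty$. **Theorem.** Assume ${\sf BE}_1'(k,N)$. Then $$\lambda_1^{(p)}\ \ge\ \inf{\rm spec}(-\Delta+k).$$ Moreover, if $1<N<\infty$, then for every $t\in[0,1]$, $$\lambda_1^{(p)}\ \ge\ \alpha_t\cdot\inf{\rm spec}\Big(-t\,\frac{N}{N-1}\Delta+k\Big),\qquad \alpha_t:=\frac N{N-1}\left[1+\frac{t/(1-t)}{(N-1)^2}\right]^{-1},$$ where $\alpha_1:=0$ (the value for $t/(1-t)=\infty$) and $0\cdot(-\infty):=0$. -/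

import Mathlib

open Set Filter Topology MeasureTheory
open scoped Manifold ContDiff ENNReal NNReal

noncomputable section

namespace RiemannSpectral

/-! ### Manifolds with a measurable Riemannian metric

`M` is a smooth manifold without boundary of dimension `n`, and
`g : Metric n M` is a Riemannian metric without any regularity (Mathlib's
`Bundle.RiemannianMetric`); the regularity that is needed is `IsLocallyElliptic`. -/

/-- The model space `ℝⁿ`. -/
abbrev Model (n : ℕ) : Type := EuclideanSpace ℝ (Fin n)

section Manifold

variable {n : ℕ} {M : Type*} [TopologicalSpace M] [ChartedSpace (Model n) M]

variable (n M) in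
/-- Riemannian metrics on `M`, without a regularity requirement. -/
abbrev Metric : Type _ :=
  Bundle.RiemannianMetric (fun x : M => TangentSpace 𝓘(ℝ, Model n) x)

variable (n M) in
/-- Vector fields on `M`, without a regularity requirement. -/
abbrev Field : Type _ := ∀ x : M, TangentSpace 𝓘(ℝ, Model n) x

/-- The coordinate vector `w ∈ ℝⁿ` as a tangent vector of `M` at the point with the coordinates
`y` in the chart `e`. -/
def coordVector (e : OpenPartialHomeomorph M (Model n)) (y w : Model n) :
    TangentSpace 𝓘(ℝ, Model n) (e.symm y) :=
  mfderiv 𝓘(ℝ, Model n) 𝓘(ℝ, Model n) e.symm y w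

/-- The metric in the chart `e`: `g_y(v, w)` for coordinate vectors `v`, `w`. -/
def Metric.chart (g : Metric n M) (e : OpenPartialHomeomorph M (Model n)) (y v w : Model n) : ℝ :=
  g.inner (e.symm y) (coordVector e y v) (coordVector e y w)

/-- The metric tensor has measurable coefficients and is locally bounded and locally uniformly
elliptic: in each chart, on each compact set, it is comparable to the Euclidean metric.
Nothing else is required; `g` may be discontinuous. -/
structure IsLocallyElliptic (g : Metric n M) : Prop where
  measurable : ∀ e ∈ atlas (Model n) M, ∀ v w : Model n,
    AEMeasurable (fun y => Metric.chart g e y v w) (volume.restrict e.target)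
  elliptic : ∀ e ∈ atlas (Model n) M, ∀ K : Set (Model n), IsCompact K → K ⊆ e.target →
    ∃ c : ℝ, 0 < c ∧ ∀ᵐ y ∂(volume.restrict K), ∀ v : Model n,
      c⁻¹ * ‖v‖ ^ 2 ≤ Metric.chart g e y v v ∧ Metric.chart g e y v v ≤ c * ‖v‖ ^ 2

/-! ### The Riemannian volume measure -/

/-- The matrix `g_ij(y)` of the metric in the chart `e`. -/
def Metric.gram (g : Metric n M) (e : OpenPartialHomeomorph M (Model n)) (y : Model n) :
    Matrix (Fin n) (Fin n) ℝ :=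
  Matrix.of fun i j =>
    Metric.chart g e y (EuclideanSpace.single i 1) (EuclideanSpace.single j 1)

/-- The measure `√(det g_ij) dy` of the chart `e`, carried over to `M`. -/
def Metric.chartVolume [MeasurableSpace M] (g : Metric n M)
    (e : OpenPartialHomeomorph M (Model n)) : Measure M :=
  Measure.map e.symm ((volume.restrict e.target).withDensity
    fun y => ENNReal.ofReal (Real.sqrt (Metric.gram g e y).det))

variable (n M) in
theorem exists_chart_cover [SecondCountableTopology M] [Nonempty M] :
    ∃ p : ℕ → M, ⋃ i, (chartAt (Model n) (p i)).source = univ := by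
  obtain ⟨s, hs, hU⟩ := TopologicalSpace.countable_cover_nhds
    (f := fun x : M => (chartAt (Model n) x).source) (fun x => chart_source_mem_nhds (Model n) x)
  have hne : s.Nonempty := by
    by_contra h
    rw [Set.not_nonempty_iff_eq_empty] at h
    subst h
    simp at hU
    exact (Set.empty_ne_univ hU).elim
  obtain ⟨p, rfl⟩ := hs.exists_eq_range hne
  exact ⟨p, by simpa using hU⟩

variable (n M) in
/-- The centres of a sequence of charts whose domains cover `M`. -/
def coverSeq [SecondCountableTopology M] [Nonempty M] : ℕ → M :=
  (exists_chart_cover n M).choose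

/-- The Riemannian volume measure: `√(det g_ij) dy` in charts, put together along a partition of
`M` into countably many Borel sets each of which lies in the domain of one chart. By the
change-of-variables formula the result does not depend on the charts. -/
def vol [MeasurableSpace M] [SecondCountableTopology M] [Nonempty M] (g : Metric n M) :
    Measure M :=
  Measure.sum fun i : ℕ =>
    (Metric.chartVolume g (chartAt (Model n) (coverSeq n M i))).restrict
      (disjointed (fun j : ℕ => (chartAt (Model n) (coverSeq n M j)).source) i)

/-! ### Weak gradients, the Dirichlet form and the Laplacian -/

/-- The norm `|G|` of a vector field. -/
def fieldNorm (g : Metric n M) (G : Field n M) (x : M) : ℝ := Real.sqrt (g.inner x (G x) (G x))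

/-- The measurable vector field `G` is the weak gradient of `u`: in every chart, `u` and
the covector `g(G, ·)` are locally integrable, and the latter is the distributional differential
of the former. -/
structure IsWeakGradient (g : Metric n M) (u : M → ℝ) (G : Field n M) : Prop where
  measurable : ∀ e ∈ atlas (Model n) M, AEMeasurable
    (fun y => (mfderiv 𝓘(ℝ, Model n) 𝓘(ℝ, Model n) e (e.symm y) (G (e.symm y)) : Model n))
    (volume.restrict e.target)
  locInt : ∀ e ∈ atlas (Model n) M, LocallyIntegrableOn (fun y => u (e.symm y)) e.target
  locInt_grad : ∀ e ∈ atlas (Model n) M, ∀ w : Model n,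
    LocallyIntegrableOn (fun y => g.inner (e.symm y) (G (e.symm y)) (coordVector e y w)) e.target
  parts : ∀ e ∈ atlas (Model n) M, ∀ ψ : Model n → ℝ, ContDiff ℝ ∞ ψ → HasCompactSupport ψ →
    tsupport ψ ⊆ e.target → ∀ w : Model n,
      ∫ y, u (e.symm y) * fderiv ℝ ψ y w
        = - ∫ y, g.inner (e.symm y) (G (e.symm y)) (coordVector e y w) * ψ y

/-- `u` lies in `W^{1,2}_loc(M) = D_loc(ℰ)` and `G = ∇u`. -/
structure IsLocSobolev (g : Metric n M) (u : M → ℝ) (G : Field n M) : Prop where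
  grad : IsWeakGradient g u G
  sq : ∀ e ∈ atlas (Model n) M, LocallyIntegrableOn (fun y => u (e.symm y) ^ 2) e.target
  sq_grad : ∀ e ∈ atlas (Model n) M, ∀ w : Model n, LocallyIntegrableOn
    (fun y => (g.inner (e.symm y) (G (e.symm y)) (coordVector e y w)) ^ 2) e.target

variable [MeasurableSpace M] [SecondCountableTopology M] [Nonempty M]

/-- `u` lies in `W^{1,2}(M) = D(ℰ)` and `G = ∇u`. -/
structure IsSobolev (g : Metric n M) (u : M → ℝ) (G : Field n M) : Prop where
  grad : IsWeakGradient g u G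
  memLp : MemLp u 2 (vol g)
  memLp_grad : MemLp (fieldNorm g G) 2 (vol g)

/-- The polarized Dirichlet form `ℰ(u, w) = ∫ ⟨∇u, ∇w⟩ dm`, in terms of the gradients. -/
def energy (g : Metric n M) (G G' : Field n M) : ℝ := ∫ x, g.inner x (G x) (G' x) ∂(vol g)

/-- `u` lies in the domain `D(Δ)` of the Laplacian, that is, of the generator of `ℰ`;
`G = ∇u` and `f = Δu`. -/
structure IsLaplacian (g : Metric n M) (u : M → ℝ) (G : Field n M) (f : M → ℝ) : Prop where
  sobolev : IsSobolev g u G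
  memLp : MemLp f 2 (vol g)
  parts : ∀ (w : M → ℝ) (W : Field n M), IsSobolev g w W →
    energy g G W = - ∫ x, f x * w x ∂(vol g)

/-! ### The mild Bakry-Émery inequality -/

/-- The mild Bakry-Émery inequality `BE₁'(k, N)`: for each `u ∈ D(Δ)` (with `G = ∇u`, `f = Δu`),
the function `v = |∇u|` lies in `D(ℰ)` (with `V = ∇v`), and for each bounded
`φ ≥ 0` in `D_loc(ℰ)` (with `P = ∇φ`) with bounded `|∇φ|`,
`∫ ∇φ (-½ ∇(v²) + ∇u Δu) + ∫ φ (Δu)² + ∫ k⁻ φ v²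
  ≥ ∫ k⁺ φ v² + ∫ φ |∇v|² + (N - 1)⁻¹ ∫ φ (|∇v| - |Δu|)²`.
Here `½ ∇(v²) = v ∇v`. The integrals with `k` may be infinite, so the inequality is one between
extended reals; `(N - 1)⁻¹` is `0` for `N = ∞`, it is `∞` for `N = 1`, and `∞ * 0 = 0`. -/
def MildBakryEmery (g : Metric n M) (k : M → ℝ) (N : ℝ≥0∞) : Prop :=
  ∀ (u : M → ℝ) (G : Field n M) (f : M → ℝ), IsLaplacian g u G f →
    ∃ V : Field n M, IsSobolev g (fieldNorm g G) V ∧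
      ∀ (φ : M → ℝ) (P : Field n M), IsLocSobolev g φ P → (∀ᵐ x ∂(vol g), 0 ≤ φ x) →
        MemLp φ ∞ (vol g) → MemLp (fieldNorm g P) ∞ (vol g) →
        (((∫⁻ x, ENNReal.ofReal (max (k x) 0 * φ x * fieldNorm g G x ^ 2) ∂(vol g))
            + (∫⁻ x, ENNReal.ofReal (φ x * fieldNorm g V x ^ 2) ∂(vol g))
            + (N - 1)⁻¹ * (∫⁻ x, ENNReal.ofReal
                (φ x * (fieldNorm g V x - |f x|) ^ 2) ∂(vol g)) : ℝ≥0∞) : EReal)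
          ≤ (((∫ x, g.inner x (P x) (-(fieldNorm g G x • V x) + f x • G x) ∂(vol g))
              + (∫ x, φ x * f x ^ 2 ∂(vol g)) : ℝ) : EReal)
            + ((∫⁻ x, ENNReal.ofReal (max (-k x) 0 * φ x * fieldNorm g G x ^ 2) ∂(vol g) :
                ℝ≥0∞) : EReal)

/-! ### Spectra -/

section Spectrum

variable {H : Type*} [NormedAddCommGroup H] [NormedSpace ℝ H]

/-- The (real) spectrum of an operator `A` in `H` given by its graph (`A u f` stands for `u ∈ D(A)`
and `A u = f`): the numbers `l` for which `A - l` is not a bijection of `D(A)` onto `H`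
with a bounded inverse `R`. -/
def graphSpectrum (A : H → H → Prop) : Set ℝ :=
  {l | ¬ ∃ R : H →L[ℝ] H, ∀ u h : H, A u (h + l • u) ↔ u = R h}

/-- The point spectrum, that is, the set of eigenvalues. -/
def graphPointSpectrum (A : H → H → Prop) : Set ℝ :=
  {l | ∃ u : H, u ≠ 0 ∧ A u (l • u)}

end Spectrum

/-- The graph of the operator `-Δ` in `L²(M, m)`. -/
def MinusLaplacian (g : Metric n M) (u h : Lp ℝ 2 (vol g)) : Prop :=
  ∃ G : Field n M, IsLaplacian g u G (fun x => -(h x))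

/-- `λ₁⁽ᵖ⁾ = inf (spec_p(-Δ) \ {0})`, which is `+∞` if there are no nonzero eigenvalues. -/
def pointSpectralGap (g : Metric n M) : EReal :=
  sInf ((fun l : ℝ => (l : EReal)) '' (graphPointSpectrum (MinusLaplacian g) \ {0}))

/-! ### Schrödinger operators -/

/-- `v` (with `V = ∇v`) lies in the domain `{v ∈ D(ℰ) : ∫ |k| v² dm < ∞}` of the quadratic form
of `-c Δ + k`. -/
structure InFormDomain (g : Metric n M) (k : M → ℝ) (v : M → ℝ) (V : Field n M) : Prop where
  sobolev : IsSobolev g v V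
  integrable : Integrable (fun x => k x * v x ^ 2) (vol g)

/-- The polarized quadratic form `c ∫ ⟨∇v, ∇w⟩ dm + ∫ k v w dm` of `-c Δ + k`. -/
def form (g : Metric n M) (c : ℝ) (k : M → ℝ) (v : M → ℝ) (V : Field n M) (w : M → ℝ)
    (W : Field n M) : ℝ :=
  c * energy g V W + ∫ x, k x * v x * w x ∂(vol g)

/-- The quadratic form of `-c Δ + k` makes sense on all of `D(ℰ)`, with values in `(-∞, ∞]`, and
is bounded from below relative to `‖v‖²`. -/
def IsSemibounded (g : Metric n M) (c : ℝ) (k : M → ℝ) : Prop :=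
  (∀ (v : M → ℝ) (V : Field n M), IsSobolev g v V →
    Integrable (fun x => max (-k x) 0 * v x ^ 2) (vol g)) ∧
  ∃ b : ℝ, ∀ (v : M → ℝ) (V : Field n M), InFormDomain g k v V →
    b * ∫ x, v x ^ 2 ∂(vol g) ≤ form g c k v V v V

/-- The graph of the operator `-c Δ + k` in `L²(M, m)`, the operator associated with (the closure
of) its quadratic form `Q`: `u ∈ D(-c Δ + k)` and `(-c Δ + k) u = h` if there are `v i` in the
form domain that converge to `u` in `L²` and are a Cauchy sequence for `Q`, and for which
`Q(v i, w) → ⟨h, w⟩` for each `w` in the form domain. -/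
def Schrodinger (g : Metric n M) (c : ℝ) (k : M → ℝ) (u h : Lp ℝ 2 (vol g)) : Prop :=
  ∃ (v : ℕ → M → ℝ) (V : ℕ → Field n M),
    (∀ i, InFormDomain g k (v i) (V i)) ∧
    Tendsto (fun i => eLpNorm (fun x => v i x - u x) 2 (vol g)) atTop (𝓝 0) ∧
    Tendsto (fun p : ℕ × ℕ => form g c k
      (fun x => v p.1 x - v p.2 x) (fun x => V p.1 x - V p.2 x)
      (fun x => v p.1 x - v p.2 x) (fun x => V p.1 x - V p.2 x)) atTop (𝓝 0) ∧
    ∀ (w : M → ℝ) (W : Field n M), InFormDomain g k w W →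
      Tendsto (fun i => form g c k (v i) (V i) w W) atTop (𝓝 (∫ x, h x * w x ∂(vol g)))

open Classical in
/-- `inf spec(-c Δ + k)`. It is `-∞` if the quadratic form of `-c Δ + k` is not bounded from
below. -/
def infSpec (g : Metric n M) (c : ℝ) (k : M → ℝ) : EReal :=
  if IsSemibounded g c k then
    sInf ((fun l : ℝ => (l : EReal)) '' graphSpectrum (Schrodinger g c k))
  else ⊥

end Manifold

/-- `α_t = N/(N-1) · [1 + (t/(1-t))/(N-1)²]⁻¹`; for `t = 1`, where `t/(1-t) = ∞`, it is `0`. -/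
def alpha (N t : ℝ) : ℝ :=
  if t = 1 then 0 else N / (N - 1) * (1 + t / (1 - t) / (N - 1) ^ 2)⁻¹

end RiemannSpectral

end

/-! The test function for the Schrödinger form is v = |∇u|, where u is an eigenfunction, -Δu = l u
with l ≠ 0. Testing the eigenvalue equation with u itself gives ∫|∇u|² = l∫u², hence l > 0, v ≠ 0
and ∫(Δu)² = l∫v² (`exists_eigenfunction`). The Bakry–Émery inequality with φ = 1
(`MildBakryEmery.integral_le`) then reads ∫kv² + ∫|∇v|² + (N-1)⁻¹∫(|∇v| - |Δu|)² ≤ l∫v². Dropping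
the last term on the left bounds the Rayleigh quotient of v for -Δ + k by l. For the second estimate
that term is kept and bounded below by the Young-type inequality (a - |f|)² ≥ (1 - s)a² + (1 -
1/s)f² (`integral_sq_sub_ge`). The choice s = N(1 - t) turns the coefficient of ∫|∇v|² into tN/(N-1)
and that of ∫(Δu)² into 1/α_t.

It remains to see that the bottom of the spectrum is at most any Rayleigh quotient (`infSpec_le`).
This is proved for operators given by an abstract semibounded form: the infimum of the Rayleigh
quotients is a spectral value, since a bounded inverse there would contradict a resolvent estimate
at a near-minimizer (`FormOperator.exists_mem_graphSpectrum_le`). Measurability in charts and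
linearity of weak gradients make the Schrödinger form an instance. -/

namespace RiemannSpectral

/-! ### Operators associated with semibounded forms

`B` is a symmetric bilinear form on a vector space `E` that is mapped into a Hilbert space `H` by
`J`. Closability of `B` is not needed. -/

section Abstract

open scoped InnerProductSpace

variable {H : Type*} [NormedAddCommGroup H] [InnerProductSpace ℝ H]
  {E : Type*} [AddCommGroup E] [Module ℝ E]

/-- The graph of the operator in `H` associated with the form `B` on `E`. -/
def FormOperator (B : LinearMap.BilinForm ℝ E) (J : E →ₗ[ℝ] H) (u h : H) : Prop :=
  ∃ v : ℕ → E, Tendsto (fun i => J (v i)) atTop (𝓝 u) ∧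
    Tendsto (fun p : ℕ × ℕ => B (v p.1 - v p.2) (v p.1 - v p.2)) atTop (𝓝 0) ∧
    ∀ w, Tendsto (fun i => B (v i) w) atTop (𝓝 ⟪h, J w⟫_ℝ)

/-- The shifted form `B - l ‖J ·‖²`. -/
noncomputable def shiftedForm (B : LinearMap.BilinForm ℝ E) (J : E →ₗ[ℝ] H) (l : ℝ) : LinearMap.BilinForm ℝ E :=
  B - l • (innerₗ H).compl₁₂ J J

theorem shiftedForm_apply (B : LinearMap.BilinForm ℝ E) (J : E →ₗ[ℝ] H) (l : ℝ) (x y : E) :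
    shiftedForm B J l x y = B x y - l * ⟪J x, J y⟫_ℝ := by
  simp [shiftedForm]

/-- The Lax-Milgram lemma on the completion of `E`, for a right-hand side in the range of `J`. -/
theorem exists_approx_solution {P : LinearMap.BilinForm ℝ E} (hP : ∀ x y, P x y = P y x)
    (h0 : ∀ x, 0 ≤ P x x) {J : E →ₗ[ℝ] H} {C : ℝ} (hC : ∀ x, ‖J x‖ ^ 2 ≤ C * P x x) (h : H) :
    ∃ (v : ℕ → E) (q : ℝ), Tendsto (fun p : ℕ × ℕ => P (v p.1 - v p.2) (v p.1 - v p.2)) atTop (𝓝 0) ∧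
      (∀ w, Tendsto (fun i => P (v i) w) atTop (𝓝 ⟪h, J w⟫_ℝ)) ∧
      Tendsto (fun i => P (v i) (v i)) atTop (𝓝 q) ∧
      Tendsto (fun i => ⟪h, J (v i)⟫_ℝ) atTop (𝓝 q) ∧ ∀ w, ⟪h, J w⟫_ℝ ^ 2 ≤ q * P w w := by
  let core : PreInnerProductSpace.Core ℝ E :=
    { inner := fun x y => P x y
      conj_inner_symm := fun x y => by simpa using hP y x
      re_inner_nonneg := fun x => by simpa using h0 x
      add_left := fun x y z => by simp
      smul_left := fun x y r => by simp }
  let : SeminormedAddCommGroup E := @InnerProductSpace.Core.toSeminormedAddCommGroup ℝ E _ _ _ core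
  let : InnerProductSpace ℝ E := InnerProductSpace.ofCore core
  have hin : ∀ x y : E, ⟪x, y⟫_ℝ = P x y := fun x y => rfl
  have hnorm : ∀ x : E, ‖x‖ ^ 2 = P x x := fun x => by
    rw [← real_inner_self_eq_norm_sq, hin]
  -- The constant C may be negative, hence the truncation under the root.
  have hbd : ∀ x : E, ‖J x‖ ≤ Real.sqrt (max C 0) * ‖x‖ := fun x => by
    refine abs_le_of_sq_le_sq' ?_ (by positivity) |>.2
    rw [mul_pow, Real.sq_sqrt (le_max_right _ _), hnorm]
    exact (hC x).trans (mul_le_mul_of_nonneg_right (le_max_left _ _) (h0 x))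
  let Jc : E →L[ℝ] H := J.mkContinuous _ hbd
  let T : E →L[ℝ] ℝ := (innerSL ℝ h).comp Jc
  let e : E →L[ℝ] UniformSpace.Completion E := UniformSpace.Completion.toComplL
  have he : ∀ x, e x = (x : UniformSpace.Completion E) := fun x => rfl
  let Te : UniformSpace.Completion E →L[ℝ] ℝ := T.extend e
  have hdense : DenseRange e := UniformSpace.Completion.denseRange_coe
  have hTe : ∀ x, Te (e x) = ⟪h, J x⟫_ℝ := fun x =>
    T.extend_eq hdense (UniformSpace.Completion.isUniformInducing_coe E) x
  -- Riesz representative of ⟪h, J ·⟫ in the completion; the sequence `v` approximates it from `E`,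
  -- and q = ‖ξ‖².
  let ξ : UniformSpace.Completion E := (InnerProductSpace.toDual ℝ _).symm Te
  have hξ : ∀ x, ⟪ξ, e x⟫_ℝ = ⟪h, J x⟫_ℝ := fun x => by
    rw [InnerProductSpace.toDual_symm_apply, hTe]
  have hee : ∀ x y, ⟪e x, e y⟫_ℝ = P x y := fun x y => UniformSpace.Completion.inner_coe x y
  obtain ⟨y, hy, hlim⟩ := mem_closure_iff_seq_limit.1 (hdense ξ)
  choose v hv using hy
  obtain rfl : (fun i => e (v i)) = y := funext hv
  refine ⟨v, ⟪ξ, ξ⟫_ℝ, ?_, fun w => ?_, ?_, ?_, fun w => ?_⟩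
  · have h1 : Tendsto (fun p : ℕ × ℕ => e (v p.1) - e (v p.2)) atTop (𝓝 (ξ - ξ)) := by
      rw [← prod_atTop_atTop_eq]
      exact (hlim.comp tendsto_fst).sub (hlim.comp tendsto_snd)
    have h2 := h1.inner h1 (𝕜 := ℝ)
    simpa only [← map_sub, hee, sub_self, inner_zero_right] using h2
  · simpa only [hee, hξ] using hlim.inner (tendsto_const_nhds (x := e w)) (𝕜 := ℝ)
  · simpa only [hee] using hlim.inner hlim (𝕜 := ℝ)
  · simpa only [hξ] using (tendsto_const_nhds (x := ξ)).inner hlim (𝕜 := ℝ)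
  · rw [← hξ, ← hee, sq]
    exact real_inner_mul_inner_self_le _ _

/-- Below its greatest lower bound, a form has a resolvent, with the usual bounds. -/
theorem FormOperator.exists_solution [CompleteSpace H] {B : LinearMap.BilinForm ℝ E}
    (hB : ∀ x y, B x y = B y x) {J : E →ₗ[ℝ] H} {b l : ℝ} (hl : l < b)
    (hb : ∀ x, b * ‖J x‖ ^ 2 ≤ B x x) (h : H) :
    ∃ u, FormOperator B J u (h + l • u) ∧ (b - l) * ‖u‖ ^ 2 ≤ ⟪h, u⟫_ℝ ∧
      ∀ w, ⟪h, J w⟫_ℝ ^ 2 ≤ ⟪h, u⟫_ℝ * (B w w - l * ‖J w‖ ^ 2) := by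
  have hbl : 0 < b - l := sub_pos.2 hl
  set P := shiftedForm B J l with hPdef
  have hPB : ∀ x y, P x y = B x y - l * ⟪J x, J y⟫_ℝ := shiftedForm_apply B J l
  have hPP : ∀ x, (b - l) * ‖J x‖ ^ 2 ≤ P x x := fun x => by
    rw [hPB, real_inner_self_eq_norm_sq]
    linarith [hb x]
  have hC : ∀ x, ‖J x‖ ^ 2 ≤ (b - l)⁻¹ * P x x := fun x => by
    rw [← div_eq_inv_mul, le_div_iff₀' hbl]
    exact hPP x
  obtain ⟨v, q, hcau, hw, hq, hhq, hle⟩ := exists_approx_solution (P := P)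
    (fun x y => by rw [hPB, hPB, hB, real_inner_comm])
    (fun x => (by positivity : 0 ≤ (b - l) * ‖J x‖ ^ 2).trans (hPP x)) hC h
  -- Coercivity turns Cauchy for `P` into Cauchy for `J` in `H`; this also lets the shift by l be
  -- undone afterwards.
  have hJ0 : Tendsto (fun p : ℕ × ℕ => ‖J (v p.1 - v p.2)‖ ^ 2) atTop (𝓝 0) :=
    squeeze_zero (fun _ => sq_nonneg _) (fun p => hC _) (by simpa using hcau.const_mul (b - l)⁻¹)
  have hJc : CauchySeq fun i => J (v i) := by
    rw [cauchySeq_iff_tendsto_dist_atTop_0]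
    have := hJ0.sqrt
    simpa only [map_sub, ← dist_eq_norm, Real.sqrt_sq dist_nonneg, Real.sqrt_zero] using this
  obtain ⟨u, hu⟩ := cauchySeq_tendsto_of_complete hJc
  have huq : ⟪h, u⟫_ℝ = q := tendsto_nhds_unique (tendsto_const_nhds.inner hu) hhq
  refine ⟨u, ⟨v, hu, ?_, fun w => ?_⟩, ?_, fun w => ?_⟩
  · have := hcau.add (hJ0.const_mul l)
    simpa only [hPB, real_inner_self_eq_norm_sq, sub_add_cancel, mul_zero, add_zero] using this
  · have := (hw w).add ((hu.inner (tendsto_const_nhds (x := J w)) (𝕜 := ℝ)).const_mul l)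
    simpa only [hPB, sub_add_cancel, inner_add_left, real_inner_smul_left] using this
  · rw [huq]
    exact le_of_tendsto_of_tendsto ((hu.norm.pow 2).const_mul (b - l)) hq
      (Eventually.of_forall fun i => hPP _)
  · simpa only [huq, hPB, real_inner_self_eq_norm_sq] using hle w

/-- The spectrum of the operator associated with a semibounded form lies not entirely above the
Rayleigh quotient of any vector. -/
theorem FormOperator.exists_mem_graphSpectrum_le [CompleteSpace H] {B : LinearMap.BilinForm ℝ E}
    (hB : ∀ x y, B x y = B y x) {J : E →ₗ[ℝ] H} {b₀ : ℝ} (hb₀ : ∀ x, b₀ * ‖J x‖ ^ 2 ≤ B x x)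
    {x₀ : E} (hx₀ : J x₀ ≠ 0) {r : ℝ} (hr : B x₀ x₀ ≤ r * ‖J x₀‖ ^ 2) :
    ∃ l ∈ graphSpectrum (FormOperator B J), l ≤ r := by
  set S : Set ℝ := {s | ∃ x, J x ≠ 0 ∧ s = B x x / ‖J x‖ ^ 2} with hS
  have hne : S.Nonempty := ⟨_, x₀, hx₀, rfl⟩
  have hpos : ∀ {x}, J x ≠ 0 → 0 < ‖J x‖ ^ 2 := fun hx => by positivity
  have hbdd : BddBelow S := by
    refine ⟨b₀, ?_⟩
    rintro _ ⟨x, hx, rfl⟩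
    exact (le_div_iff₀ (hpos hx)).2 (hb₀ x)
  set b := sInf S with hbdef
  have hb : ∀ x, b * ‖J x‖ ^ 2 ≤ B x x := fun x => by
    by_cases hx : J x = 0
    -- On the kernel of `J` the quotient is undefined, but semiboundedness gives B x x ≥ 0.
    · simpa [hx] using hb₀ x
    · exact (le_div_iff₀ (hpos hx)).1 (csInf_le hbdd ⟨x, hx, rfl⟩)
  refine ⟨b, ?_, (csInf_le hbdd ⟨x₀, hx₀, rfl⟩).trans ((div_le_iff₀ (hpos hx₀)).2 hr)⟩
  rintro ⟨R, hR⟩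
  -- Chosen so that 4‖R‖ε < 1; the added 1 covers R = 0.
  set ε : ℝ := (4 * (‖R‖ + 1))⁻¹ with hε
  have hε0 : 0 < ε := by positivity
  obtain ⟨_, ⟨x, hx, rfl⟩, hxε⟩ := exists_lt_of_csInf_lt hne (show sInf S < b + ε by linarith)
  have hxp := hpos hx
  rw [div_lt_iff₀ hxp] at hxε
  obtain ⟨u, hu, hu1, hu2⟩ :=
    FormOperator.exists_solution hB (show b - ε < b by linarith) hb (J x)
  rw [sub_sub_cancel] at hu1
  -- The equation at b - ε is rewritten as one at b with right-hand side J x - εu. Only the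
  -- implication from the graph to `R` is used.
  have huR : u = R (J x - ε • u) := by
    rw [← hR]
    convert hu using 1
    rw [sub_smul]
    abel
  have hin : ⟪J x, u⟫_ℝ ≤ ‖J x‖ * ‖u‖ := real_inner_le_norm _ _
  have hεu : ε * ‖u‖ ≤ ‖J x‖ := by
    by_contra! hlt
    have : 0 < ‖u‖ := pos_of_mul_pos_right ((norm_nonneg _).trans_lt hlt) hε0.le
    nlinarith
  have hnu : ‖u‖ ≤ ‖R‖ * (2 * ‖J x‖) := by
    calc ‖u‖ = ‖R (J x - ε • u)‖ := congrArg _ huR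
      _ ≤ ‖R‖ * ‖J x - ε • u‖ := R.le_opNorm _
      _ ≤ ‖R‖ * (2 * ‖J x‖) := by
        gcongr
        refine (norm_sub_le _ _).trans ?_
        rw [norm_smul, Real.norm_of_nonneg hε0.le]
        linarith
  -- Taken at the near-minimizer: ‖J x‖⁴ ≤ ⟪J x, u⟫ (B x x - (b - ε)‖J x‖²). The first factor is at
  -- most 2‖R‖‖J x‖² and the second is below 2ε‖J x‖², so the product is too small.
  have hJ := hu2 x
  rw [real_inner_self_eq_norm_sq] at hJ
  have h1 : ⟪J x, u⟫_ℝ ≤ 2 * ‖R‖ * ‖J x‖ ^ 2 := by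
    nlinarith [mul_le_mul_of_nonneg_left hnu (norm_nonneg (J x))]
  have h2 : B x x - (b - ε) * ‖J x‖ ^ 2 < 2 * ε * ‖J x‖ ^ 2 := by linarith
  have h3 : 0 ≤ B x x - (b - ε) * ‖J x‖ ^ 2 := by nlinarith [hb x]
  have h4 : (‖J x‖ ^ 2) ^ 2 ≤ 2 * ‖R‖ * ‖J x‖ ^ 2 * (2 * ε * ‖J x‖ ^ 2) :=
    hJ.trans (mul_le_mul h1 h2.le h3 (by positivity))
  have h5 : 2 * ‖R‖ * ‖J x‖ ^ 2 * (2 * ε * ‖J x‖ ^ 2)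
      = (‖R‖ / (‖R‖ + 1)) * (‖J x‖ ^ 2) ^ 2 := by
    rw [hε]
    field_simp
    ring
  have h6 : ‖R‖ / (‖R‖ + 1) < 1 := by
    rw [div_lt_one (by positivity)]
    linarith
  nlinarith [mul_lt_mul_of_pos_right h6 (pow_pos hxp 2)]

end Abstract
/-! ### Measurability in charts -/

section Manifold

variable {n : ℕ} {M : Type*} [TopologicalSpace M] [ChartedSpace (Model n) M]

/-- A measurable modification in coordinates is pulled back by `e`. The exceptional set stays null
because the chart measure is the image of one that is absolutely continuous with respect to Lebesgue
measure. -/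
theorem aemeasurable_chartVolume [MeasurableSpace M] [BorelSpace M] (g : Metric n M)
    (e : OpenPartialHomeomorph M (Model n)) {F : M → ℝ}
    (hF : AEMeasurable (fun y => F (e.symm y)) (volume.restrict e.target)) :
    AEMeasurable F ((Metric.chartVolume g e).restrict e.source) := by
  have hes : AEMeasurable e.symm ((volume.restrict e.target).withDensity
      fun y => ENNReal.ofReal (Real.sqrt (Metric.gram g e y).det)) :=
    (e.continuousOn_symm.aemeasurable e.open_target.measurableSet).mono_ac
      (withDensity_absolutelyContinuous _ _)
  have hms := e.open_source.measurableSet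
  have hme : Measurable (e.source.domRestrict e) :=
    (continuousOn_iff_continuous_domRestrict.1 e.continuousOn).measurable
  obtain ⟨Φ, hΦ, hae⟩ := hF
  have hΦe : Measurable (e.source.indicator (Φ ∘ e)) := by
    refine measurable_of_restrict_of_restrict_compl hms ?_ ?_
    · convert hΦ.comp hme using 1
      ext x
      simp
    · convert measurable_const (a := (0 : ℝ)) using 1
      ext x
      simp [indicator_of_notMem x.2]
  refine ⟨_, hΦe, ?_⟩
  obtain ⟨T, hTsub, hT, hT0⟩ := exists_measurable_superset_of_null (ae_iff.1 hae)
  rw [Filter.EventuallyEq, ae_restrict_iff' hms]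
  have hS : MeasurableSet (e.source ∩ e ⁻¹' T) := by
    convert hms.subtype_image (hme hT) using 1
    ext x
    simp [and_comm]
  refine mem_of_superset (compl_mem_ae_iff.2
    (show Metric.chartVolume g e (e.source ∩ e ⁻¹' T) = 0 from ?_)) ?_
  · rw [Metric.chartVolume, Measure.map_apply_of_aemeasurable hes hS]
    refine withDensity_absolutelyContinuous _ _ (measure_mono_null_ae ?_ hT0)
    filter_upwards [ae_restrict_mem e.open_target.measurableSet] with y hy hyS
    have := hyS.2
    rwa [mem_preimage, e.right_inv hy] at this
  · intro x hx hxs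
    rw [indicator_of_mem hxs]
    by_contra hne
    refine hx ⟨hxs, hTsub ?_⟩
    simpa [e.left_inv hxs] using hne

/-- A function on `M` that is measurable in charts is measurable. -/
theorem aemeasurable_vol [MeasurableSpace M] [BorelSpace M] [SecondCountableTopology M] [Nonempty M]
    (g : Metric n M) {F : M → ℝ} (hF : ∀ e ∈ atlas (Model n) M,
      AEMeasurable (fun y => F (e.symm y)) (volume.restrict e.target)) :
    AEMeasurable F (vol g) := by
  refine aemeasurable_sum_measure_iff.2 fun i => ?_
  exact (aemeasurable_chartVolume g _ (hF _ (chart_mem_atlas _ _))).mono_measure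
    (Measure.restrict_mono (disjointed_subset _ _) le_rfl)

theorem coordVector_mfderiv [IsManifold 𝓘(ℝ, Model n) ∞ M]
    {e : OpenPartialHomeomorph M (Model n)} (he : e ∈ atlas (Model n) M) {y : Model n}
    (hy : y ∈ e.target) (v : TangentSpace 𝓘(ℝ, Model n) (e.symm y)) :
    coordVector e y (mfderiv 𝓘(ℝ, Model n) 𝓘(ℝ, Model n) e (e.symm y) v) = v := by
  have : IsManifold 𝓘(ℝ, Model n) 1 M := IsManifold.of_le (n := ∞) (by norm_num)
  have h := (mdifferentiable_of_mem_atlas (I := 𝓘(ℝ, Model n)) he).symm_comp_deriv (e.map_target hy)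
  -- The points `e (e.symm y)` and `y` are equal only propositionally, so the derivatives are
  -- compared as maps of the model space.
  have key : ∀ z, z = y →
      (mfderiv 𝓘(ℝ, Model n) 𝓘(ℝ, Model n) e.symm z : Model n →L[ℝ] Model n)
        = mfderiv 𝓘(ℝ, Model n) 𝓘(ℝ, Model n) e.symm y := by
    rintro _ rfl; rfl
  have h2 := DFunLike.congr_fun h v
  have h3 := DFunLike.congr_fun (key (e (e.symm y)) (e.right_inv hy))
    (mfderiv 𝓘(ℝ, Model n) 𝓘(ℝ, Model n) e (e.symm y) v)
  exact h3.symm.trans h2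

theorem coordVector_sum (e : OpenPartialHomeomorph M (Model n)) (y a : Model n) :
    coordVector e y a = ∑ i, a i • coordVector e y (EuclideanSpace.single i 1) := by
  have ha : a = ∑ i, a i • EuclideanSpace.single i (1 : ℝ) := by
    ext j
    simp [Finset.sum_apply, Pi.single_apply]
  let L : Model n →L[ℝ] TangentSpace 𝓘(ℝ, Model n) (e.symm y) :=
    mfderiv 𝓘(ℝ, Model n) 𝓘(ℝ, Model n) e.symm y
  change L a = ∑ i, a i • L (EuclideanSpace.single i 1)
  conv_lhs => rw [ha]
  rw [map_sum]
  simp only [map_smul]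

/-- In a chart the inner product is ∑ aⁱ bʲ g_ij, where the components and the metric coefficients
are all measurable. -/
theorem aemeasurable_inner [MeasurableSpace M] [BorelSpace M] [SecondCountableTopology M]
    [Nonempty M] [IsManifold 𝓘(ℝ, Model n) ∞ M] {g : Metric n M} (hg : IsLocallyElliptic g)
    {u u' : M → ℝ} {G G' : Field n M} (hG : IsWeakGradient g u G) (hG' : IsWeakGradient g u' G') :
    AEMeasurable (fun x => g.inner x (G x) (G' x)) (vol g) := by
  refine aemeasurable_vol g fun e he => ?_
  have ha := hG.measurable e he
  have hb := hG'.measurable e he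
  set a : Model n → Model n :=
    fun y => mfderiv 𝓘(ℝ, Model n) 𝓘(ℝ, Model n) e (e.symm y) (G (e.symm y)) with hadef
  set b : Model n → Model n :=
    fun y => mfderiv 𝓘(ℝ, Model n) 𝓘(ℝ, Model n) e (e.symm y) (G' (e.symm y)) with hbdef
  have hmeas : AEMeasurable (fun y => ∑ i, ∑ j, a y i * (b y j * Metric.chart g e y
      (EuclideanSpace.single i 1) (EuclideanSpace.single j 1))) (volume.restrict e.target) := by
    refine Finset.aemeasurable_fun_sum _ fun i _ => Finset.aemeasurable_fun_sum _ fun j _ => ?_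
    refine AEMeasurable.mul ?_ (AEMeasurable.mul ?_ (hg.measurable e he _ _))
    · exact (EuclideanSpace.proj (𝕜 := ℝ) i).continuous.measurable.comp_aemeasurable ha
    · exact (EuclideanSpace.proj (𝕜 := ℝ) j).continuous.measurable.comp_aemeasurable hb
  refine hmeas.congr ?_
  filter_upwards [ae_restrict_mem e.open_target.measurableSet] with y hy
  have h1 : G (e.symm y) = ∑ i, a y i • coordVector e y (EuclideanSpace.single i 1) := by
    rw [← coordVector_sum, hadef, coordVector_mfderiv he hy]
  have h2 : G' (e.symm y) = ∑ i, b y i • coordVector e y (EuclideanSpace.single i 1) := by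
    rw [← coordVector_sum, hbdef, coordVector_mfderiv he hy]
  rw [h1, h2]
  simp only [map_sum, map_smul, sum_apply, smul_apply, smul_eq_mul, Metric.chart,
    Finset.mul_sum]
  rw [Finset.sum_comm]
  simp only [mul_left_comm]

end Manifold
section Manifold

variable {n : ℕ} {M : Type*} [TopologicalSpace M] [ChartedSpace (Model n) M]

/-! ### Sobolev functions form a vector space -/

theorem integrable_mul_of_tsupport_subset {s : Set (Model n)} {F χ : Model n → ℝ}
    (hF : LocallyIntegrableOn F s) (hχ : Continuous χ) {K : Set (Model n)} (hK : IsCompact K)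
    (hKs : K ⊆ s) (hχK : ∀ y ∉ K, χ y = 0) : Integrable fun y => F y * χ y := by
  refine ((hF.integrableOn_compact_subset hKs hK).mul_continuousOn hχ.continuousOn
    hK).integrable_of_forall_notMem_eq_zero fun y hy => ?_
  rw [hχK y hy, mul_zero]

theorem IsWeakGradient.add {g : Metric n M} {u u' : M → ℝ} {G G' : Field n M}
    (h : IsWeakGradient g u G) (h' : IsWeakGradient g u' G') :
    IsWeakGradient g (u + u') (G + G') where
  measurable e he := by
    refine ((h.measurable e he).add (h'.measurable e he)).congr (Eventually.of_forall fun y => ?_)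
    exact (map_add (mfderiv 𝓘(ℝ, Model n) 𝓘(ℝ, Model n) e (e.symm y)) _ _).symm
  locInt e he := (h.locInt e he).add (h'.locInt e he)
  locInt_grad e he w := by
    simp only [Pi.add_apply, map_add, add_apply]
    exact (h.locInt_grad e he w).add (h'.locInt_grad e he w)
  parts e he ψ hψ hc hs w := by
    have hd : Continuous fun y => fderiv ℝ ψ y w :=
      (hψ.continuous_fderiv (by simp)).clm_apply continuous_const
    have hd0 : ∀ y ∉ tsupport ψ, fderiv ℝ ψ y w = 0 := fun y hy => by
      rw [image_eq_zero_of_notMem_tsupport fun h => hy (tsupport_fderiv_subset ℝ h)]; simp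
    have h0 : ∀ y ∉ tsupport ψ, ψ y = 0 := fun y hy => image_eq_zero_of_notMem_tsupport hy
    simp only [Pi.add_apply, map_add, add_apply, add_mul]
    rw [integral_add, integral_add, h.parts e he ψ hψ hc hs w, h'.parts e he ψ hψ hc hs w, neg_add]
    · exact integrable_mul_of_tsupport_subset (h.locInt_grad e he w) hψ.continuous hc hs h0
    · exact integrable_mul_of_tsupport_subset (h'.locInt_grad e he w) hψ.continuous hc hs h0
    · exact integrable_mul_of_tsupport_subset (h.locInt e he) hd hc hs hd0
    · exact integrable_mul_of_tsupport_subset (h'.locInt e he) hd hc hs hd0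

theorem IsWeakGradient.smul {g : Metric n M} {u : M → ℝ} {G : Field n M}
    (h : IsWeakGradient g u G) (c : ℝ) : IsWeakGradient g (c • u) (c • G) where
  measurable e he := by
    refine ((h.measurable e he).const_smul c).congr (Eventually.of_forall fun y => ?_)
    exact (map_smul (mfderiv 𝓘(ℝ, Model n) 𝓘(ℝ, Model n) e (e.symm y)) _ _).symm
  locInt e he := (h.locInt e he).smul c
  locInt_grad e he w := by
    simp only [Pi.smul_apply, map_smul, smul_apply]
    exact (h.locInt_grad e he w).smul c
  parts e he ψ hψ hc hs w := by
    simp only [Pi.smul_apply, map_smul, smul_apply, smul_eq_mul, mul_assoc]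
    rw [integral_const_mul, integral_const_mul, h.parts e he ψ hψ hc hs w, mul_neg]

theorem isWeakGradient_const (g : Metric n M) (c : ℝ) : IsWeakGradient g (fun _ => c) 0 where
  measurable e he := by
    refine (aemeasurable_const (b := (0 : Model n))).congr (Eventually.of_forall fun y => ?_)
    exact (map_zero (mfderiv 𝓘(ℝ, Model n) 𝓘(ℝ, Model n) e (e.symm y))).symm
  locInt e he := locallyIntegrableOn_const _
  locInt_grad e he w := by
    simpa only [Pi.zero_apply, map_zero, zero_apply] using locallyIntegrableOn_zero
  parts e he ψ hψ hc hs w := by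
    have hd : Continuous fun y => fderiv ℝ ψ y w :=
      (hψ.continuous_fderiv (by simp)).clm_apply continuous_const
    have hdc : HasCompactSupport fun y => fderiv ℝ ψ y w := hc.fderiv_apply ℝ w
    simp only [Pi.zero_apply, map_zero, zero_apply, zero_mul, integral_zero, neg_zero]
    have := integral_smul_fderiv_eq_neg_fderiv_smul_of_integrable (μ := (volume : Measure (Model n)))
      (f := fun _ => c) (g := ψ) (v := w) (by simp)
      ((hd.integrable_of_hasCompactSupport hdc).const_mul c)
      ((hψ.continuous.integrable_of_hasCompactSupport hc).const_mul c)
      (by fun_prop) (fun x _ => (hψ.differentiable (by simp)) x)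
    simpa using this

/-- Makes φ = 1 admissible in the Bakry–Émery inequality, whatever the volume of `M`. -/
theorem isLocSobolev_const (g : Metric n M) (c : ℝ) : IsLocSobolev g (fun _ => c) 0 where
  grad := isWeakGradient_const g c
  sq e he := locallyIntegrableOn_const _
  sq_grad e he w := by
    simpa only [Pi.zero_apply, map_zero, zero_apply, ne_eq, OfNat.ofNat_ne_zero, not_false_eq_true,
      zero_pow] using locallyIntegrableOn_zero

theorem inner_self_nonneg (g : Metric n M) (x : M) (v : TangentSpace 𝓘(ℝ, Model n) x) :
    0 ≤ g.inner x v v := by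
  by_cases hv : v = 0
  · simp [hv]
  · exact (g.pos x v hv).le

theorem fieldNorm_sq (g : Metric n M) (G : Field n M) (x : M) :
    fieldNorm g G x ^ 2 = g.inner x (G x) (G x) :=
  Real.sq_sqrt (inner_self_nonneg g x _)

theorem fieldNorm_zero (g : Metric n M) : fieldNorm g 0 = 0 := by
  ext x
  simp [fieldNorm]

theorem inner_add_self (g : Metric n M) (x : M) (v w : TangentSpace 𝓘(ℝ, Model n) x) :
    g.inner x (v + w) (v + w) = g.inner x v v + 2 * g.inner x v w + g.inner x w w := by
  simp only [map_add, add_apply, g.symm x w v]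
  ring

theorem abs_inner_le (g : Metric n M) (x : M) (v w : TangentSpace 𝓘(ℝ, Model n) x) :
    2 * |g.inner x v w| ≤ g.inner x v v + g.inner x w w := by
  have h1 := inner_self_nonneg g x (v + w)
  have h2 := inner_self_nonneg g x (v + -w)
  rw [inner_add_self] at h1 h2
  simp only [map_neg, neg_apply, neg_neg] at h2
  rcases abs_cases (g.inner x v w) with ⟨h, _⟩ | ⟨h, _⟩ <;> rw [h] <;> linarith

variable [MeasurableSpace M] [SecondCountableTopology M] [Nonempty M]

theorem isSobolev_zero (g : Metric n M) : IsSobolev g 0 0 where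
  grad := isWeakGradient_const g 0
  memLp := MemLp.zero
  memLp_grad := by
    rw [fieldNorm_zero]
    exact MemLp.zero

/-- Follows from |kvw| ≤ |k|v² + |k|w²; it makes the polarized potential term bilinear. -/
theorem InFormDomain.integrable_mul {g : Metric n M} {k : M → ℝ} (hk : AEMeasurable k (vol g))
    {v w : M → ℝ} {V W : Field n M} (hv : InFormDomain g k v V) (hw : InFormDomain g k w W) :
    Integrable (fun x => k x * v x * w x) (vol g) := by
  refine (hv.integrable.norm.add hw.integrable.norm).mono'
    ((hk.aestronglyMeasurable.mul hv.sobolev.memLp.1).mul hw.sobolev.memLp.1)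
    (Eventually.of_forall fun x => ?_)
  simp only [Pi.add_apply, norm_mul, norm_pow, Real.norm_eq_abs]
  nlinarith [mul_nonneg (abs_nonneg (k x)) (sq_nonneg (|v x| - |w x|)),
    mul_nonneg (abs_nonneg (k x)) (sq_nonneg |v x|),
    mul_nonneg (abs_nonneg (k x)) (sq_nonneg |w x|)]

theorem form_symm (g : Metric n M) (c : ℝ) (k : M → ℝ) (v : M → ℝ) (V : Field n M) (w : M → ℝ)
    (W : Field n M) : form g c k v V w W = form g c k w W v V := by
  simp only [form, energy, g.symm _ (V _) (W _), mul_right_comm (k _) (v _) (w _)]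

section

variable [BorelSpace M] [IsManifold 𝓘(ℝ, Model n) ∞ M]

theorem memLp_fieldNorm_iff {g : Metric n M} (hg : IsLocallyElliptic g) {u : M → ℝ} {G : Field n M}
    (h : IsWeakGradient g u G) :
    MemLp (fieldNorm g G) 2 (vol g) ↔ Integrable (fun x => g.inner x (G x) (G x)) (vol g) := by
  rw [memLp_two_iff_integrable_sq]
  · simp only [fieldNorm_sq]
  · exact (aemeasurable_inner hg h h).sqrt.aestronglyMeasurable

theorem IsSobolev.integrable_inner_self {g : Metric n M} (hg : IsLocallyElliptic g) {u : M → ℝ}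
    {G : Field n M} (h : IsSobolev g u G) : Integrable (fun x => g.inner x (G x) (G x)) (vol g) :=
  (memLp_fieldNorm_iff hg h.grad).1 h.memLp_grad

theorem IsSobolev.integrable_inner {g : Metric n M} (hg : IsLocallyElliptic g) {u u' : M → ℝ}
    {G G' : Field n M} (h : IsSobolev g u G) (h' : IsSobolev g u' G') :
    Integrable (fun x => g.inner x (G x) (G' x)) (vol g) := by
  refine ((h.integrable_inner_self hg).add (h'.integrable_inner_self hg)).mono'
    (aemeasurable_inner hg h.grad h'.grad).aestronglyMeasurable (Eventually.of_forall fun x => ?_)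
  have := abs_inner_le g x (G x) (G' x)
  simp only [Pi.add_apply, Real.norm_eq_abs]
  linarith [abs_nonneg (g.inner x (G x) (G' x))]

theorem IsSobolev.add {g : Metric n M} (hg : IsLocallyElliptic g) {u u' : M → ℝ}
    {G G' : Field n M} (h : IsSobolev g u G) (h' : IsSobolev g u' G') :
    IsSobolev g (u + u') (G + G') where
  grad := h.grad.add h'.grad
  memLp := h.memLp.add h'.memLp
  memLp_grad := by
    rw [memLp_fieldNorm_iff hg (h.grad.add h'.grad)]
    simp only [Pi.add_apply, inner_add_self]
    exact ((h.integrable_inner_self hg).add ((h.integrable_inner hg h').const_mul 2)).add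
      (h'.integrable_inner_self hg)

theorem IsSobolev.smul {g : Metric n M} (hg : IsLocallyElliptic g) {u : M → ℝ}
    {G : Field n M} (h : IsSobolev g u G) (c : ℝ) : IsSobolev g (c • u) (c • G) where
  grad := h.grad.smul c
  memLp := h.memLp.const_smul c
  memLp_grad := by
    rw [memLp_fieldNorm_iff hg (h.grad.smul c)]
    simp only [Pi.smul_apply, map_smul, smul_apply, smul_eq_mul]
    exact ((h.integrable_inner_self hg).const_mul c).const_mul c

/-! ### The form of a Schrödinger operator -/

/-- The form domain of `-c Δ + k`, as a space of functions together with their gradients. -/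
noncomputable def formDomain {g : Metric n M} (hg : IsLocallyElliptic g) {k : M → ℝ}
    (hk : AEMeasurable k (vol g)) : Submodule ℝ ((M → ℝ) × Field n M) where
  carrier := {p | InFormDomain g k p.1 p.2}
  zero_mem' := ⟨isSobolev_zero g, by simp⟩
  add_mem' {p q} hp hq := by
    refine ⟨hp.sobolev.add hg hq.sobolev, ?_⟩
    have := (hp.integrable.add ((hp.integrable_mul hk hq).const_mul 2)).add hq.integrable
    refine this.congr (Eventually.of_forall fun x => ?_)
    simp only [Pi.add_apply, Prod.fst_add]
    ring
  smul_mem' c p hp := by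
    refine ⟨hp.sobolev.smul hg c, ?_⟩
    refine (hp.integrable.const_mul (c ^ 2)).congr (Eventually.of_forall fun x => ?_)
    simp only [Prod.smul_fst, Pi.smul_apply, smul_eq_mul]
    ring

/-- The quadratic form of `-c Δ + k` as a bilinear form. -/
noncomputable def formBilin {g : Metric n M} (hg : IsLocallyElliptic g) {k : M → ℝ}
    (hk : AEMeasurable k (vol g)) (c : ℝ) : LinearMap.BilinForm ℝ (formDomain hg hk) :=
  have hadd : ∀ p q r : formDomain hg hk, form g c k (p + q : formDomain hg hk).1.1
      (p + q : formDomain hg hk).1.2 r.1.1 r.1.2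
      = form g c k p.1.1 p.1.2 r.1.1 r.1.2 + form g c k q.1.1 q.1.2 r.1.1 r.1.2 := by
    intro p q r
    simp only [form, energy, Submodule.coe_add, Prod.fst_add, Prod.snd_add, Pi.add_apply, map_add,
      add_apply, mul_add, add_mul]
    rw [integral_add (p.2.sobolev.integrable_inner hg r.2.sobolev)
      (q.2.sobolev.integrable_inner hg r.2.sobolev),
      integral_add (p.2.integrable_mul hk r.2) (q.2.integrable_mul hk r.2)]
    ring
  have hsmul : ∀ (a : ℝ) (p r : formDomain hg hk), form g c k (a • p : formDomain hg hk).1.1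
      (a • p : formDomain hg hk).1.2 r.1.1 r.1.2 = a • form g c k p.1.1 p.1.2 r.1.1 r.1.2 := by
    intro a p r
    simp only [form, energy, Submodule.coe_smul, Prod.smul_fst, Prod.smul_snd, Pi.smul_apply,
      map_smul, smul_apply, smul_eq_mul, mul_left_comm (k _) a, mul_assoc, integral_const_mul]
    ring
  LinearMap.mk₂ ℝ (fun p q => form g c k p.1.1 p.1.2 q.1.1 q.1.2) hadd hsmul
    (fun p q r => by
      rw [form_symm, hadd, form_symm, form_symm (v := r.1.1)])
    (fun a p r => by
      rw [form_symm, hsmul, form_symm])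

theorem formBilin_apply {g : Metric n M} (hg : IsLocallyElliptic g) {k : M → ℝ}
    (hk : AEMeasurable k (vol g)) (c : ℝ) (p q : formDomain hg hk) :
    formBilin hg hk c p q = form g c k p.1.1 p.1.2 q.1.1 q.1.2 := rfl

/-- The map of the form domain to `L²`. -/
noncomputable def formDomainToLp {g : Metric n M} (hg : IsLocallyElliptic g) {k : M → ℝ}
    (hk : AEMeasurable k (vol g)) : formDomain hg hk →ₗ[ℝ] Lp ℝ 2 (vol g) where
  toFun p := p.2.sobolev.memLp.toLp p.1.1
  map_add' p q := MemLp.toLp_add p.2.sobolev.memLp q.2.sobolev.memLp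
  map_smul' a p := MemLp.toLp_const_smul a p.2.sobolev.memLp

theorem coeFn_formDomainToLp {g : Metric n M} (hg : IsLocallyElliptic g) {k : M → ℝ}
    (hk : AEMeasurable k (vol g)) (p : formDomain hg hk) :
    formDomainToLp hg hk p =ᵐ[vol g] p.1.1 := p.2.sobolev.memLp.coeFn_toLp

theorem norm_formDomainToLp_sq {g : Metric n M} (hg : IsLocallyElliptic g) {k : M → ℝ}
    (hk : AEMeasurable k (vol g)) (p : formDomain hg hk) :
    ‖formDomainToLp hg hk p‖ ^ 2 = ∫ x, p.1.1 x ^ 2 ∂(vol g) := by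
  rw [← real_inner_self_eq_norm_sq, L2.inner_def]
  refine integral_congr_ae ?_
  filter_upwards [coeFn_formDomainToLp hg hk p] with x hx
  rw [hx, real_inner_self_eq_norm_sq, Real.norm_eq_abs, sq_abs]

/-- The bridge by which the abstract spectral result applies to -cΔ + k. -/
theorem schrodinger_eq_formOperator {g : Metric n M} (hg : IsLocallyElliptic g) {k : M → ℝ}
    (hk : AEMeasurable k (vol g)) (c : ℝ) :
    Schrodinger g c k = FormOperator (formBilin hg hk c) (formDomainToLp hg hk) := by
  have hlim : ∀ (v : ℕ → formDomain hg hk) (u : Lp ℝ 2 (vol g)),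
      Tendsto (fun i => formDomainToLp hg hk (v i)) atTop (𝓝 u) ↔
        Tendsto (fun i => eLpNorm (fun x => (v i).1.1 x - u x) 2 (vol g)) atTop (𝓝 0) := by
    intro v u
    rw [Lp.tendsto_Lp_iff_tendsto_eLpNorm']
    refine tendsto_congr fun i => eLpNorm_congr_ae ?_
    filter_upwards [coeFn_formDomainToLp hg hk (v i)] with x hx
    simp [hx]
  have hinn : ∀ (h : Lp ℝ 2 (vol g)) (w : formDomain hg hk),
      inner ℝ h (formDomainToLp hg hk w) = ∫ x, h x * w.1.1 x ∂(vol g) := by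
    intro h w
    rw [L2.inner_def]
    refine integral_congr_ae ?_
    filter_upwards [coeFn_formDomainToLp hg hk w] with x hx
    rw [hx]
    simp [mul_comm]
  ext u h
  constructor
  · rintro ⟨v, V, hv, h1, h2, h3⟩
    refine ⟨fun i => ⟨(v i, V i), hv i⟩, (hlim _ _).2 h1, h2, fun w => ?_⟩
    rw [hinn]
    exact h3 _ _ w.2
  · rintro ⟨v, h1, h2, h3⟩
    refine ⟨fun i => (v i).1.1, fun i => (v i).1.2, fun i => (v i).2, (hlim _ _).1 h1, h2,
      fun w W hw => ?_⟩
    have := h3 ⟨(w, W), hw⟩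
    rwa [hinn] at this

/-- The variational principle: `inf spec (-c Δ + k)` is at most every Rayleigh quotient. -/
theorem infSpec_le {g : Metric n M} (hg : IsLocallyElliptic g) {k : M → ℝ}
    (hk : AEMeasurable k (vol g)) {c r : ℝ} {v : M → ℝ} {V : Field n M}
    (hv : IsSemibounded g c k → InFormDomain g k v V ∧ form g c k v V v V ≤ r * ∫ x, v x ^ 2 ∂(vol g))
    (hv0 : 0 < ∫ x, v x ^ 2 ∂(vol g)) : infSpec g c k ≤ r := by
  unfold infSpec
  split_ifs with hs
  -- Semiboundedness may be assumed for the test function, since otherwise the infimum is `⊥` by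
  -- definition.
  · obtain ⟨hvd, hvr⟩ := hv hs
    obtain ⟨b, hb⟩ := hs.2
    let p : formDomain hg hk := ⟨(v, V), hvd⟩
    have hp := norm_formDomainToLp_sq hg hk p
    obtain ⟨l, hl, hlr⟩ := FormOperator.exists_mem_graphSpectrum_le (B := formBilin hg hk c)
      (J := formDomainToLp hg hk) (fun x y => form_symm _ _ _ _ _ _ _) (b₀ := b)
      (fun x => by
        rw [norm_formDomainToLp_sq]
        exact hb _ _ x.2)
      (x₀ := p) (r := r) (fun h0 => by simp [h0] at hp; exact hv0.ne hp) (by rw [hp]; exact hvr)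
    rw [schrodinger_eq_formOperator hg hk]
    exact (sInf_le (mem_image_of_mem _ hl)).trans (EReal.coe_le_coe_iff.2 hlr)
  · exact bot_le

end

end Manifold
-- The pointwise difference of the two sides is the square s⁻¹(sa - |f|)².
theorem integral_sq_sub_ge {X : Type*} [MeasurableSpace X] {μ : Measure X} {a f : X → ℝ} (ha : MemLp a 2 μ) (hf : MemLp f 2 μ)
    {s : ℝ} (hs : 0 < s) :
    (1 - s) * ∫ x, a x ^ 2 ∂μ + (1 - s⁻¹) * ∫ x, f x ^ 2 ∂μ ≤ ∫ x, (a x - |f x|) ^ 2 ∂μ := by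
  rw [← integral_const_mul, ← integral_const_mul,
    ← integral_add (ha.integrable_sq.const_mul _) (hf.integrable_sq.const_mul _)]
  refine integral_mono ((ha.integrable_sq.const_mul _).add (hf.integrable_sq.const_mul _))
    (ha.sub hf.abs).integrable_sq fun x => ?_
  have h : (a x - |f x|) ^ 2 - ((1 - s) * a x ^ 2 + (1 - s⁻¹) * f x ^ 2)
      = s⁻¹ * (s * a x - |f x|) ^ 2 := by
    rw [← sq_abs (f x)]
    field_simp
    ring
  have : 0 ≤ s⁻¹ * (s * a x - |f x|) ^ 2 := by positivity
  simp only
  linarith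

section Manifold

variable {n : ℕ} {M : Type*} [TopologicalSpace M] [ChartedSpace (Model n) M]
  [MeasurableSpace M] [SecondCountableTopology M] [Nonempty M]

/-! ### The Bakry-Émery inequality for eigenfunctions -/

/-- A nonzero eigenvalue `l` of `-Δ` is positive, and the eigenfunction `u` satisfies
`‖Δu‖² = l ‖∇u‖²` with `∇u ≠ 0`. -/
theorem exists_eigenfunction {g : Metric n M} {l : ℝ}
    (hl : l ∈ graphPointSpectrum (MinusLaplacian g) \ {0}) :
    0 < l ∧ ∃ (u : M → ℝ) (G : Field n M) (f : M → ℝ), IsLaplacian g u G f ∧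
      0 < ∫ x, fieldNorm g G x ^ 2 ∂(vol g) ∧
      ∫ x, f x ^ 2 ∂(vol g) = l * ∫ x, fieldNorm g G x ^ 2 ∂(vol g) := by
  obtain ⟨⟨u, hu0, G, hG⟩, hl0⟩ := hl
  have hl0 : l ≠ 0 := hl0
  have hcoe : (fun x => (l • u : Lp ℝ 2 (vol g)) x) =ᵐ[vol g] fun x => l * u x := by
    filter_upwards [Lp.coeFn_smul l u] with x hx
    simpa using hx
  have hnorm : ∫ x, u x ^ 2 ∂(vol g) = ‖u‖ ^ 2 := by
    rw [← real_inner_self_eq_norm_sq, L2.inner_def]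
    simp only [real_inner_self_eq_norm_sq, Real.norm_eq_abs, sq_abs]
  have hupos : 0 < ∫ x, u x ^ 2 ∂(vol g) := by
    rw [hnorm]
    positivity
  have hE : ∫ x, fieldNorm g G x ^ 2 ∂(vol g) = l * ∫ x, u x ^ 2 ∂(vol g) := by
    -- The eigenfunction is its own test function.
    have h := hG.parts u G hG.sobolev
    rw [energy, ← integral_neg] at h
    simp only [fieldNorm_sq]
    rw [h, ← integral_const_mul]
    refine integral_congr_ae ?_
    filter_upwards [hcoe] with x hx
    rw [hx]
    ring
  have hE0 : 0 ≤ ∫ x, fieldNorm g G x ^ 2 ∂(vol g) := integral_nonneg fun x => sq_nonneg _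
  have hlpos : 0 < l := by
    rw [hE] at hE0
    exact lt_of_le_of_ne (nonneg_of_mul_nonneg_left hE0 hupos) hl0.symm
  refine ⟨hlpos, u, G, _, hG, by rw [hE]; positivity, ?_⟩
  rw [hE, ← mul_assoc, ← integral_const_mul]
  refine integral_congr_ae ?_
  filter_upwards [hcoe] with x hx
  rw [hx]
  ring

/-- The mild Bakry-Émery inequality with `φ = 1`. -/
theorem MildBakryEmery.integral_le {g : Metric n M} {k : M → ℝ}
    (hk : AEMeasurable k (vol g)) {N : ℝ≥0∞} (hBE : MildBakryEmery g k N) {u f : M → ℝ}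
    {G : Field n M} (hu : IsLaplacian g u G f) :
    ∃ V : Field n M, IsSobolev g (fieldNorm g G) V ∧
      (Integrable (fun x => max (-k x) 0 * fieldNorm g G x ^ 2) (vol g) →
        InFormDomain g k (fieldNorm g G) V ∧ ∀ ρ : ℝ, 0 ≤ ρ → ENNReal.ofReal ρ ≤ (N - 1)⁻¹ →
          ∫ x, k x * fieldNorm g G x ^ 2 ∂(vol g) + ∫ x, fieldNorm g V x ^ 2 ∂(vol g)
            + ρ * ∫ x, (fieldNorm g V x - |f x|) ^ 2 ∂(vol g) ≤ ∫ x, f x ^ 2 ∂(vol g)) := by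
  obtain ⟨V, hV, h⟩ := hBE u G f hu
  refine ⟨V, hV, fun hint => ?_⟩
  have h1 := h (fun _ => 1) 0 (isLocSobolev_const g 1) (by simp) (memLp_top_const 1)
    (by rw [fieldNorm_zero]; exact MemLp.zero)
  have hD0 : 0 ≤ ∫ x, f x ^ 2 ∂(vol g) := integral_nonneg fun x => sq_nonneg _
  simp only [Pi.zero_apply, map_zero, zero_apply, integral_zero, mul_one, one_mul, zero_add] at h1
  rw [← max_eq_left hD0, ← EReal.coe_ennreal_ofReal, ← EReal.coe_ennreal_add,
    EReal.coe_ennreal_le_coe_ennreal_iff] at h1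
  have hVi : Integrable (fun x => fieldNorm g V x ^ 2) (vol g) := hV.memLp_grad.integrable_sq
  have hCi : Integrable (fun x => (fieldNorm g V x - |f x|) ^ 2) (vol g) :=
    (hV.memLp_grad.sub hu.memLp.abs).integrable_sq
  have hA0 : 0 ≤ fun x => max (k x) 0 * fieldNorm g G x ^ 2 := fun x => by
    simp only [Pi.zero_apply]; positivity
  have hK0 : 0 ≤ fun x => max (-k x) 0 * fieldNorm g G x ^ 2 := fun x => by
    simp only [Pi.zero_apply]; positivity
  -- Integrability of k⁺v² comes from the inequality itself: it is a summand of a side bounded by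
  -- ∫f² + ∫k⁻v² < ∞.
  have hAi : Integrable (fun x => max (k x) 0 * fieldNorm g G x ^ 2) (vol g) := by
    rw [← lintegral_ofReal_ne_top_iff_integrable _ (Eventually.of_forall hA0)]
    · refine ne_top_of_le_ne_top ?_ ((le_add_right le_self_add).trans h1)
      exact ENNReal.add_ne_top.2 ⟨ENNReal.ofReal_ne_top, hint.lintegral_lt_top.ne⟩
    · exact ((hk.max aemeasurable_const).mul (hV.memLp.1.aemeasurable.pow_const 2)).aestronglyMeasurable
  have hsplit : ∀ x, k x * fieldNorm g G x ^ 2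
      = max (k x) 0 * fieldNorm g G x ^ 2 - max (-k x) 0 * fieldNorm g G x ^ 2 := fun x => by
    rw [← sub_mul]
    congr 1
    rcases le_total (k x) 0 with hx | hx
    · simp [hx]
    · simp [hx]
  refine ⟨⟨hV, ?_⟩, fun ρ hρ hρN => ?_⟩
  · simp only [hsplit]
    exact hAi.sub hint
  -- Replacing (N-1)⁻¹, possibly infinite, by a smaller real weight ρ makes every term finite.
  · replace h1 := (add_le_add_right (mul_le_mul_left hρN _) _).trans h1
    simp only [hsplit]
    rw [integral_sub hAi hint]
    have hA1 := integral_nonneg (μ := vol g) hA0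
    have hK1 := integral_nonneg (μ := vol g) hK0
    have hV1 : 0 ≤ ∫ x, fieldNorm g V x ^ 2 ∂(vol g) := integral_nonneg fun x => sq_nonneg _
    have hC1 : 0 ≤ ∫ x, (fieldNorm g V x - |f x|) ^ 2 ∂(vol g) :=
      integral_nonneg fun x => sq_nonneg _
    rw [← ofReal_integral_eq_lintegral_ofReal hAi (Eventually.of_forall hA0),
      ← ofReal_integral_eq_lintegral_ofReal hint (Eventually.of_forall hK0),
      ← ofReal_integral_eq_lintegral_ofReal hVi (Eventually.of_forall fun x => sq_nonneg _),
      ← ofReal_integral_eq_lintegral_ofReal hCi (Eventually.of_forall fun x => sq_nonneg _),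
      ← ENNReal.ofReal_mul hρ, ← ENNReal.ofReal_add hA1 hV1,
      ← ENNReal.ofReal_add (add_nonneg hA1 hV1) (mul_nonneg hρ hC1), ← ENNReal.ofReal_add hD0 hK1,
      ENNReal.ofReal_le_ofReal_iff (add_nonneg hD0 hK1)] at h1
    linarith

/-! ### The constant α_t and the two eigenvalue estimates -/

theorem alpha_pos {ν t : ℝ} (hν : 1 < ν) (ht0 : 0 ≤ t) (ht1 : t < 1) : 0 < alpha ν t := by
  have h1 : 0 < ν - 1 := sub_pos.2 hν
  have h2 : 0 < 1 - t := sub_pos.2 ht1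
  rw [alpha, if_neg ht1.ne]
  positivity

/-- The right-hand side is the coefficient of ∫(Δu)² that remains after the Young-type inequality
with s = ν(1 - t). -/
theorem inv_alpha {ν t : ℝ} (hν : 1 < ν) (ht1 : t < 1) :
    (alpha ν t)⁻¹ = 1 - (ν - 1)⁻¹ * (1 - (ν * (1 - t))⁻¹) := by
  have h1 : ν - 1 ≠ 0 := (sub_pos.2 hν).ne'
  have h2 : 1 - t ≠ 0 := (sub_pos.2 ht1).ne'
  have h3 : ν ≠ 0 := (zero_lt_one.trans hν).ne'
  rw [alpha, if_neg ht1.ne, mul_inv, inv_inv, inv_div]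
  field_simp
  ring

variable [BorelSpace M] [IsManifold 𝓘(ℝ, Model n) ∞ M]

theorem infSpec_one_le_pointSpectralGap {g : Metric n M} (hg : IsLocallyElliptic g) {k : M → ℝ}
    (hk : AEMeasurable k (vol g)) {N : ℝ≥0∞} (hBE : MildBakryEmery g k N) :
    infSpec g 1 k ≤ pointSpectralGap g := by
  refine le_sInf ?_
  rintro _ ⟨l, hl, rfl⟩
  obtain ⟨-, u, G, f, hu, hpos, hf⟩ := exists_eigenfunction hl
  obtain ⟨V, hV, h⟩ := hBE.integral_le hk hu
  refine infSpec_le hg hk (V := V) (fun hs => ?_) hpos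
  obtain ⟨hd, hle⟩ := h (hs.1 _ _ hV)
  -- The weight 0 discards the dimensional term and is allowed for every N.
  have := hle 0 le_rfl (by simp)
  simp only [fieldNorm_sq g V, hf] at this
  refine ⟨hd, ?_⟩
  simp only [form, energy, mul_assoc, ← sq]
  linarith

theorem alpha_mul_infSpec_le_pointSpectralGap {g : Metric n M} (hg : IsLocallyElliptic g)
    {k : M → ℝ} (hk : AEMeasurable k (vol g)) {N : ℝ≥0∞} (hBE : MildBakryEmery g k N)
    (hN : 1 < N) (hN' : N ≠ ⊤) {t : ℝ} (ht0 : 0 ≤ t) (ht1 : t ≤ 1) :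
    ((alpha N.toReal t : ℝ) : EReal) * infSpec g (t * (N.toReal / (N.toReal - 1))) k
      ≤ pointSpectralGap g := by
  set ν := N.toReal with hνdef
  have hνN : N = ENNReal.ofReal ν := (ENNReal.ofReal_toReal hN').symm
  have hν : 1 < ν := by
    rw [hνdef, ← ENNReal.toReal_one]
    exact (ENNReal.toReal_lt_toReal ENNReal.one_ne_top hN').2 hN
  have hν1 : 0 < ν - 1 := sub_pos.2 hν
  refine le_sInf ?_
  rintro _ ⟨l, hl, rfl⟩
  obtain ⟨hl0, u, G, f, hu, hpos, hf⟩ := exists_eigenfunction hl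
  rcases ht1.eq_or_lt with rfl | ht1
  -- At t = 1 the left side is 0, even if the infimum is `⊥`, as 0 · (-∞) = 0 in `EReal`.
  · simpa [alpha] using hl0.le
  have hα := alpha_pos hν ht0 ht1
  have hs : 0 < ν * (1 - t) := mul_pos (zero_lt_one.trans hν) (sub_pos.2 ht1)
  obtain ⟨V, hV, h⟩ := hBE.integral_le hk hu
  have key : infSpec g (t * (ν / (ν - 1))) k ≤ (((alpha ν t)⁻¹ * l : ℝ) : EReal) := by
    refine infSpec_le hg hk (V := V) (fun hsb => ?_) hpos
    obtain ⟨hd, hle⟩ := h (hsb.1 _ _ hV)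
    have h1 := hle (ν - 1)⁻¹ (inv_nonneg.2 hν1.le) (by
      rw [ENNReal.ofReal_inv_of_pos hν1, ENNReal.ofReal_sub _ zero_le_one, ENNReal.ofReal_one,
        ← hνN])
    have h2 := mul_le_mul_of_nonneg_left (integral_sq_sub_ge hV.memLp_grad hu.memLp hs)
      (inv_nonneg.2 hν1.le)
    -- This identity dictates s = ν(1 - t): the coefficient of ∫|∇v|² becomes that of the form.
    have hc : 1 + (ν - 1)⁻¹ * (1 - ν * (1 - t)) = t * (ν / (ν - 1)) := by
      field_simp
      ring
    refine ⟨hd, ?_⟩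
    simp only [form, energy, mul_assoc, ← sq, ← fieldNorm_sq g V]
    rw [inv_alpha hν ht1, ← hf, ← mul_assoc, ← hc]
    linarith
  calc ((alpha ν t : ℝ) : EReal) * infSpec g (t * (ν / (ν - 1))) k
      ≤ ((alpha ν t : ℝ) : EReal) * (((alpha ν t)⁻¹ * l : ℝ) : EReal) :=
        mul_le_mul_of_nonneg_left key (EReal.coe_nonneg.2 hα.le)
    _ = (l : EReal) := by rw [← EReal.coe_mul, mul_inv_cancel_left₀ hα.ne']

end Manifold
end RiemannSpectral

theorem mainTheorem3 {n : ℕ} (hn : 2 ≤ n) {M : Type*} [TopologicalSpace M] [T2Space M]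
    [SecondCountableTopology M] [Nonempty M] [ChartedSpace (RiemannSpectral.Model n) M]
    [IsManifold 𝓘(ℝ, RiemannSpectral.Model n) ∞ M] [MeasurableSpace M] [BorelSpace M]
    (g : RiemannSpectral.Metric n M) (hg : RiemannSpectral.IsLocallyElliptic g)
    (k : M → ℝ) (hk : AEMeasurable k (RiemannSpectral.vol g))
    (N : ℝ≥0∞) (hN : 1 ≤ N) (hBE : RiemannSpectral.MildBakryEmery g k N) :
    RiemannSpectral.infSpec g 1 k ≤ RiemannSpectral.pointSpectralGap g ∧
      (1 < N → N ≠ ⊤ → ∀ t : ℝ, t ∈ Set.Icc (0 : ℝ) 1 →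
        ((RiemannSpectral.alpha N.toReal t : ℝ) : EReal)
            * RiemannSpectral.infSpec g (t * (N.toReal / (N.toReal - 1))) k
          ≤ RiemannSpectral.pointSpectralGap g) :=
  ⟨RiemannSpectral.infSpec_one_le_pointSpectralGap hg hk hBE, fun hN1 hNt _ ht =>
    RiemannSpectral.alpha_mul_infSpec_le_pointSpectralGap hg hk hBE hN1 hNt ht.1 ht.2⟩
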